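/- Let $H$ be an infinite-dimensional real Hilbert space, viewed as a many-sorted metric structure as follows. For every integer $n\ge 1$ there is a sort $B_n(H)=\{x\in H : \|x\|\le n\}$ with the metric $d(x,y)=\|x-y\|$; there are function symbols for the inclusions $B_m(H)\to B_n(H)$ ($m\le n$), for $+,-:B_n(H)\times B_n(H)\to B_{2n}(H)$, and for multiplication by each real $r$, $B_n(H)\to B_{kn}(H)$, where $k$ is the natural number with $k-1\le |r|<k$; and there are predicate symbols for $\langle\cdot,\cdot\rangle$ on $B_n(H)\times B_n(H)$ and for $\|\cdot\|$ on $B_n(H)$. Formulas are those of continuous logic: they are built from the atomic formulas by continuous functions as connectives and by the quantifiers $\sup$ and $\inf$ over the sorts. Let $A\subseteq H$. A predicate $P:B_n(H)\times B_m(H)\to\mathbb R$ is $A$-definable if it is a uniform limit of interpretations of formulas $\varphi_j(x,y)$ with parameters from $A$. A map $f:H\to H$ is $A$-definable if $f(B_n(H))$ is bounded for every $n\ge 1$ and if, for all $n,m\ge 1$ with $f(B_n(H))\subseteq B_m(H)$, the predicate $(x,y)\mapsto d(f(x),y)$ on $B_n(H)\times B_m(H)$ is $A$-definable. A map is definable if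 it is $A$-definable for some $A\subseteq H$. **Theorem.** 1. A bounded linear operator $T:H\to H$ is definable if and only if there are $\lambda\in\mathbb R$ and a compact operator $K:H\to H$ such that $T=\lambda I+K$. 2. Let $\mathfrak B(H)$ be the algebra of bounded linear operators on $H$, let $\mathfrak B_0(H)$ be its ideal of compact operators, and let $\pi:\mathfrak B(H)\to\mathfrak C(H)=\mathfrak B(H)/\mathfrak B_0(H)$ be the quotient map onto the Calkin algebra, whose unit is $e$. Then the definable linear operators $H\to H$ form a subalgebra $\mathfrak D(H)$ of $\mathfrak B(H)$, and $\mathfrak D(H)=\pi^{-1}(\mathbb R\cdot e)$. -/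

import Mathlib

noncomputable section

namespace HilbertLogic

universe u

/-! The many-sorted metric structure of a real Hilbert space `H`: the sorts are the closed balls
`B_n(H)`, `n ≥ 1`, each with the metric `d(x, y) = ‖x - y‖`. -/

section Ball

variable (H : Type u) [NormedAddCommGroup H]

/-- The sort `B_n(H)`; it carries the metric induced from `H`. -/
abbrev Ball (n : ℕ+) : Type u := {x : H // ‖x‖ ≤ (n : ℝ)}

/-- An assignment of values to the variables. Every sort `B_n(H)` has countably many variables,
and `v n i` is the value of the `i`-th variable of sort `B_n(H)`. -/
abbrev Assignment : Type u := ∀ n : ℕ+, ℕ → Ball H n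

end Ball

section Update

variable {H : Type u} [NormedAddCommGroup H]

/-- Change the value of the `i`-th variable of sort `B_n(H)` to `x`. -/
def Assignment.update (v : Assignment H) (n : ℕ+) (i : ℕ) (x : Ball H n) : Assignment H :=
  Function.update v n (Function.update (v n) i x)

end Update

/-- The unique natural number `k` with `k - 1 ≤ |r| < k`. -/
def scalarBound (r : ℝ) : ℕ+ := Nat.succPNat ⌊|r|⌋₊

theorem abs_lt_scalarBound (r : ℝ) : |r| < (scalarBound r : ℝ) := by
  simpa [scalarBound] using Nat.lt_floor_add_one |r|

variable {H : Type u} [NormedAddCommGroup H] [InnerProductSpace ℝ H]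

namespace Ball

/-! Interpretation of the function symbols. -/

/-- The inclusion `I_{m,n} : B_m(H) → B_n(H)` for `m ≤ n`. -/
def incl {m n : ℕ+} (h : m ≤ n) (x : Ball H m) : Ball H n :=
  ⟨x.1, x.2.trans (by exact_mod_cast h)⟩

/-- Addition `B_n(H) × B_n(H) → B_{2n}(H)`. -/
def add {n : ℕ+} (x y : Ball H n) : Ball H (2 * n) :=
  ⟨x.1 + y.1, by
    have h := norm_add_le x.1 y.1
    have hx := x.2
    have hy := y.2
    push_cast
    linarith⟩

/-- Subtraction `B_n(H) × B_n(H) → B_{2n}(H)`. -/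
def sub {n : ℕ+} (x y : Ball H n) : Ball H (2 * n) :=
  ⟨x.1 - y.1, by
    have h := norm_sub_le x.1 y.1
    have hx := x.2
    have hy := y.2
    push_cast
    linarith⟩

/-- Multiplication by `r`, a map `B_n(H) → B_{kn}(H)` with `k - 1 ≤ |r| < k`. -/
def smul (r : ℝ) {n : ℕ+} (x : Ball H n) : Ball H (scalarBound r * n) :=
  ⟨r • x.1, by
    rw [norm_smul, Real.norm_eq_abs]
    push_cast
    exact mul_le_mul (abs_lt_scalarBound r).le x.2 (norm_nonneg _) (by positivity)⟩

end Ball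

/-- Terms of sort `B_n(H)` with parameters from `A`: every `a ∈ A` is a constant symbol of each
sort that contains it. -/
inductive Term (A : Set H) : ℕ+ → Type u
  | var (n : ℕ+) (i : ℕ) : Term A n
  | param (a : H) (ha : a ∈ A) (n : ℕ+) (hn : ‖a‖ ≤ (n : ℝ)) : Term A n
  | incl {m n : ℕ+} (h : m ≤ n) (t : Term A m) : Term A n
  | add {n : ℕ+} (t s : Term A n) : Term A (2 * n)
  | sub {n : ℕ+} (t s : Term A n) : Term A (2 * n)
  | smul (r : ℝ) {n : ℕ+} (t : Term A n) : Term A (scalarBound r * n)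

namespace Term

variable {A : Set H}

/-- The value of a term. -/
def realize (v : Assignment H) : {n : ℕ+} → Term A n → Ball H n
  | _, var n i => v n i
  | _, param a _ _ hn => ⟨a, hn⟩
  | _, incl h t => (t.realize v).incl h
  | _, add t s => (t.realize v).add (s.realize v)
  | _, sub t s => (t.realize v).sub (s.realize v)
  | _, smul r t => (t.realize v).smul r

/-- The variables of a term, as pairs (sort, index). -/
def vars : {n : ℕ+} → Term A n → Set (ℕ+ × ℕ)
  | _, var n i => {(n, i)}
  | _, param _ _ _ _ => ∅
  | _, incl _ t => t.vars
  | _, add t s => t.vars ∪ s.vars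
  | _, sub t s => t.vars ∪ s.vars
  | _, smul _ t => t.vars

end Term

/-- Formulas of continuous logic with parameters from `A`. The atomic formulas are built with the
metric, the inner product and the norm; the connectives are all continuous functions
`ℝ^k → ℝ`; the quantifiers are `sup` and `inf` over a variable of one of the sorts. -/
inductive Formula (A : Set H) : Type u
  | dist {n : ℕ+} (t s : Term A n) : Formula A
  | inner {n : ℕ+} (t s : Term A n) : Formula A
  | norm {n : ℕ+} (t : Term A n) : Formula A
  | conn {k : ℕ} (c : C(Fin k → ℝ, ℝ)) (φ : Fin k → Formula A) : Formula A
  | sup (n : ℕ+) (i : ℕ) (φ : Formula A) : Formula A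
  | inf (n : ℕ+) (i : ℕ) (φ : Formula A) : Formula A

namespace Formula

variable {A : Set H}

/-- The value of a formula. The suprema and infima are over a nonempty bounded set, see
`Formula.exists_bound`. -/
def realize : Formula A → Assignment H → ℝ
  | dist t s, v => Dist.dist (t.realize v) (s.realize v)
  | inner t s, v => Inner.inner ℝ (t.realize v : H) (s.realize v : H)
  | norm t, v => ‖(t.realize v : H)‖
  | conn c φ, v => c fun j => (φ j).realize v
  | sup n i φ, v => ⨆ x : Ball H n, φ.realize (v.update n i x)
  | inf n i φ, v => ⨅ x : Ball H n, φ.realize (v.update n i x)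

/-- The free variables of a formula, as pairs (sort, index). -/
def freeVars : Formula A → Set (ℕ+ × ℕ)
  | dist t s => t.vars ∪ s.vars
  | inner t s => t.vars ∪ s.vars
  | norm t => t.vars
  | conn _ φ => ⋃ j, (φ j).freeVars
  | sup n i φ => φ.freeVars \ {(n, i)}
  | inf n i φ => φ.freeVars \ {(n, i)}

theorem exists_bound (φ : Formula A) : ∃ C : ℝ, ∀ v : Assignment H, |φ.realize v| ≤ C := by
  induction φ with
  | @dist n t s =>
    refine ⟨n + n, fun v => ?_⟩
    have h := norm_sub_le (t.realize v : H) (s.realize v : H)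
    have ht := (t.realize v).2
    have hs := (s.realize v).2
    simp only [realize, Subtype.dist_eq, dist_eq_norm, abs_norm]
    linarith
  | @inner n t s =>
    refine ⟨n * n, fun v => (abs_real_inner_le_norm _ _).trans ?_⟩
    exact mul_le_mul (t.realize v).2 (s.realize v).2 (norm_nonneg _) (by positivity)
  | @norm n t =>
    refine ⟨n, fun v => ?_⟩
    simpa [realize] using (t.realize v).2
  | @conn k c φ ih =>
    choose C hC using ih
    have hK : IsCompact (Set.pi Set.univ fun j : Fin k => Set.Icc (-C j) (C j)) :=
      isCompact_univ_pi fun j => isCompact_Icc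
    obtain ⟨D, hD⟩ := hK.exists_bound_of_continuousOn (f := c) c.continuous.continuousOn
    exact ⟨D, fun v => hD _ fun j _ => abs_le.mp (hC j v)⟩
  | sup n i φ ih =>
    obtain ⟨C, hC⟩ := ih
    refine ⟨C, fun v => ?_⟩
    have : Nonempty (Ball H n) := ⟨⟨0, by simp⟩⟩
    have h : ∀ x, φ.realize (v.update n i x) ≤ C := fun x => (abs_le.mp (hC _)).2
    refine abs_le.mpr ⟨?_, ciSup_le h⟩
    exact (abs_le.mp (hC (v.update n i ⟨0, by simp⟩))).1.trans
      (le_ciSup (f := fun x => φ.realize (v.update n i x)) ⟨C, by rintro _ ⟨x, rfl⟩; exact h x⟩ _)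
  | inf n i φ ih =>
    obtain ⟨C, hC⟩ := ih
    refine ⟨C, fun v => ?_⟩
    have : Nonempty (Ball H n) := ⟨⟨0, by simp⟩⟩
    have h : ∀ x, -C ≤ φ.realize (v.update n i x) := fun x => (abs_le.mp (hC _)).1
    refine abs_le.mpr ⟨le_ciInf h, ?_⟩
    exact (ciInf_le (f := fun x => φ.realize (v.update n i x))
      ⟨-C, by rintro _ ⟨x, rfl⟩; exact h x⟩ _).trans (abs_le.mp (hC (v.update n i ⟨0, by simp⟩))).2

end Formula

/-- A predicate on `B_n(H) × B_m(H)` is `A`-definable if it is a uniform limit of (the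
interpretations of) a sequence of formulas `φ_j(x, y)` with parameters from `A`, in the free
variables `x` (the variable of sort `B_n(H)` with index `0`) and `y` (the variable of sort
`B_m(H)` with index `1`) only. -/
def IsDefinablePred (A : Set H) (n m : ℕ+) (P : Ball H n → Ball H m → ℝ) : Prop :=
  ∃ φ : ℕ → Formula A, (∀ j, (φ j).freeVars ⊆ {(n, 0), (m, 1)}) ∧
    ∀ ε : ℝ, 0 < ε → ∃ N : ℕ, ∀ j, N ≤ j → ∀ v : Assignment H,
      |(φ j).realize v - P (v n 0) (v m 1)| ≤ ε

/-- A map `f : H → H` is `A`-definable if the image of each ball `B_n(H)` is bounded and, for all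
`n` and all `m` with `f(B_n(H)) ⊆ B_m(H)`, the predicate `d(f(x), y)` on `B_n(H) × B_m(H)` is
`A`-definable. -/
def IsDefinableOver (A : Set H) (f : H → H) : Prop :=
  (∀ n : ℕ+, Bornology.IsBounded (f '' {x : H | ‖x‖ ≤ (n : ℝ)})) ∧
    ∀ n m : ℕ+, (∀ x : H, ‖x‖ ≤ (n : ℝ) → ‖f x‖ ≤ (m : ℝ)) →
      IsDefinablePred A n m fun x y => dist (f x) (y : H)

/-- Definability with parameters. -/
def IsDefinable (f : H → H) : Prop := ∃ A : Set H, IsDefinableOver A f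

variable (H) in
/-- The ideal of compact operators in the algebra of bounded operators. -/
def compactIdeal : Ideal (H →L[ℝ] H) where
  carrier := {K | IsCompactOperator K}
  add_mem' := fun {K L} (hK : IsCompactOperator K) (hL : IsCompactOperator L) => hK.add hL
  zero_mem' := isCompactOperator_zero
  smul_mem' := fun T K (hK : IsCompactOperator K) => hK.clm_comp T

instance : (compactIdeal H).IsTwoSided :=
  ⟨fun {K} T (hK : IsCompactOperator K) => hK.comp_clm T⟩

variable (H) in
/-- The Calkin algebra. -/
abbrev Calkin : Type u := (H →L[ℝ] H) ⧸ compactIdeal H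

variable (H) in
/-- The quotient map onto the Calkin algebra. -/
abbrev calkinMap : (H →L[ℝ] H) →ₐ[ℝ] Calkin H := Ideal.Quotient.mkₐ ℝ (compactIdeal H)

end HilbertLogic

end

namespace HilbertLogic

variable {H : Type*} [NormedAddCommGroup H] [InnerProductSpace ℝ H]

/-! ### Invariance of formulas under isometries fixing the parameters -/

/-! A formula has finitely many parameters and is invariant under isometries fixing them, so a
definable `T` almost commutes, uniformly on the unit ball, with all such isometries. Testing this on
the reflection that negates a unit vector `x` orthogonal to the parameters makes `x` almost an
eigenvector (`IsDefinable.exists_submodule_norm_sub_le`). An operator of this kind is nearly scalar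
off a finite-dimensional subspace (`exists_norm_sub_smul_le`), hence close to scalar plus finite
rank; scalars plus compacts form a closed space, so `T` lies in it.

Conversely, on each ball a compact operator is a uniform limit of finite-rank ones, for which the
distance to `y` is a continuous function of inner products, so a quantifier-free formula
(`isExpressible_norm_finiteRank`). -/

/-- The action of a linear isometry on a ball. -/
def Ball.mapEquiv (U : H ≃ₗᵢ[ℝ] H) (n : ℕ+) : Ball H n ≃ Ball H n where
  toFun x := ⟨U x, by simpa using x.2⟩
  invFun x := ⟨U.symm x, by simpa using x.2⟩
  left_inv x := by simp
  right_inv x := by simp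

/-- The action of a linear isometry on assignments. -/
def Assignment.map (U : H ≃ₗᵢ[ℝ] H) (v : Assignment H) : Assignment H :=
  fun n i => Ball.mapEquiv U n (v n i)

theorem Assignment.map_update (U : H ≃ₗᵢ[ℝ] H) (v : Assignment H) (n : ℕ+) (i : ℕ)
    (x : Ball H n) :
    (v.update n i x).map U = (v.map U).update n i (Ball.mapEquiv U n x) := by
  funext m j
  simp only [Assignment.map, Assignment.update]
  by_cases hm : m = n
  · subst hm
    by_cases hj : j = i
    · subst hj
      simp
    · simp [hj, Assignment.map]
  · simp [hm, Assignment.map]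

theorem Term.exists_finset_realize_map {A : Set H} {n : ℕ+} (t : Term A n) :
    ∃ F : Finset H, ∀ U : H ≃ₗᵢ[ℝ] H, (∀ a ∈ F, U a = a) → ∀ v : Assignment H,
      (t.realize (v.map U) : H) = U (t.realize v) := by
  classical
  induction t with
  | var n i => exact ⟨∅, fun U _ v => rfl⟩
  | param a ha n hn => exact ⟨{a}, fun U hU v => (hU a (by simp)).symm⟩
  | incl h t ih => exact ih
  | add t s iht ihs =>
    obtain ⟨F, hF⟩ := iht
    obtain ⟨G, hG⟩ := ihs
    refine ⟨F ∪ G, fun U hU v => ?_⟩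
    simp [realize, Ball.add, hF U (fun a ha => hU a (by simp [ha])),
      hG U (fun a ha => hU a (by simp [ha]))]
  | sub t s iht ihs =>
    obtain ⟨F, hF⟩ := iht
    obtain ⟨G, hG⟩ := ihs
    refine ⟨F ∪ G, fun U hU v => ?_⟩
    simp [realize, Ball.sub, hF U (fun a ha => hU a (by simp [ha])),
      hG U (fun a ha => hU a (by simp [ha]))]
  | smul r t ih =>
    obtain ⟨F, hF⟩ := ih
    exact ⟨F, fun U hU v => by simp [realize, Ball.smul, hF U hU]⟩

/-- A formula is invariant under all linear isometries that fix its finitely many parameters. -/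
theorem Formula.exists_finset_realize_map {A : Set H} (φ : Formula A) :
    ∃ F : Finset H, ∀ U : H ≃ₗᵢ[ℝ] H, (∀ a ∈ F, U a = a) → ∀ v : Assignment H,
      φ.realize (v.map U) = φ.realize v := by
  classical
  induction φ with
  | dist t s =>
    obtain ⟨F, hF⟩ := t.exists_finset_realize_map
    obtain ⟨G, hG⟩ := s.exists_finset_realize_map
    refine ⟨F ∪ G, fun U hU v => ?_⟩
    simp [realize, Subtype.dist_eq, hF U (fun a ha => hU a (by simp [ha])),
      hG U (fun a ha => hU a (by simp [ha]))]
  | inner t s =>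
    obtain ⟨F, hF⟩ := t.exists_finset_realize_map
    obtain ⟨G, hG⟩ := s.exists_finset_realize_map
    refine ⟨F ∪ G, fun U hU v => ?_⟩
    simp [realize, hF U (fun a ha => hU a (by simp [ha])),
      hG U (fun a ha => hU a (by simp [ha]))]
  | norm t =>
    obtain ⟨F, hF⟩ := t.exists_finset_realize_map
    exact ⟨F, fun U hU v => by simp [realize, hF U hU]⟩
  | conn c φ ih =>
    choose F hF using ih
    refine ⟨Finset.univ.biUnion F, fun U hU v => ?_⟩
    simp only [realize]
    congr 1
    funext j
    exact hF j U (fun a ha => hU a (Finset.mem_biUnion.2 ⟨j, Finset.mem_univ j, ha⟩)) v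
  | sup n i φ ih =>
    obtain ⟨F, hF⟩ := ih
    refine ⟨F, fun U hU v => ?_⟩
    -- `U` permutes the ball, so reindexing by it leaves the supremum unchanged.
    refine ((Ball.mapEquiv U n).iSup_congr fun x => ?_).symm
    rw [← Assignment.map_update, hF U hU]
  | inf n i φ ih =>
    obtain ⟨F, hF⟩ := ih
    refine ⟨F, fun U hU v => ?_⟩
    refine ((Ball.mapEquiv U n).iInf_congr fun x => ?_).symm
    rw [← Assignment.map_update, hF U hU]

/-- The distinct indices 0 and 1 prevent a clash even if `n = m`; sorts too small for the vector get
0. -/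
theorem exists_assignment {E : Type*} [NormedAddCommGroup E] (n m : ℕ+) (x : Ball E n)
    (y : Ball E m) : ∃ v : Assignment E, v n 0 = x ∧ v m 1 = y := by
  classical
  let z (i : ℕ) : E := if i = 0 then x else y
  refine ⟨fun k i => if h : ‖z i‖ ≤ (k : ℝ) then ⟨z i, h⟩ else ⟨0, by simp⟩, ?_, ?_⟩
  · simp [z, x.2]
  · simp [z, y.2]

/-- A definable operator almost commutes with all linear isometries that fix a suitable
finite set. -/
theorem IsDefinable.exists_finset_norm_sub_le {T : H →L[ℝ] H} (hT : IsDefinable (T : H → H))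
    {ε : ℝ} (hε : 0 < ε) :
    ∃ F : Finset H, ∀ U : H ≃ₗᵢ[ℝ] H, (∀ a ∈ F, U a = a) → ∀ x : H, ‖x‖ ≤ 1 →
      ‖T (U x) - U (T x)‖ ≤ 2 * ε := by
  obtain ⟨A, -, hA⟩ := hT
  let m : ℕ+ := Nat.succPNat ⌈‖T‖⌉₊
  have hm : ∀ x : H, ‖x‖ ≤ ((1 : ℕ+) : ℝ) → ‖T x‖ ≤ (m : ℝ) := fun x hx => by
    have h1 : ‖T x‖ ≤ ‖T‖ := T.unit_le_opNorm x (by simpa using hx)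
    have h2 : ‖T‖ ≤ ⌈‖T‖⌉₊ := Nat.le_ceil _
    have h3 : (m : ℝ) = ⌈‖T‖⌉₊ + 1 := by simp [m]
    linarith
  obtain ⟨φ, -, hφ⟩ := hA 1 m hm
  obtain ⟨N, hN⟩ := hφ ε hε
  obtain ⟨F, hF⟩ := (φ N).exists_finset_realize_map
  refine ⟨F, fun U hU x hx => ?_⟩
  have hx' : ‖x‖ ≤ ((1 : ℕ+) : ℝ) := by simpa using hx
  -- With `y = T x` the predicate is 0 at `v` and the desired norm at `v.map U`, while the formula
  -- agrees at both: two errors of `ε`.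
  obtain ⟨v, hv0, hv1⟩ := exists_assignment 1 m ⟨x, hx'⟩ ⟨T x, hm x hx'⟩
  have h1 := hN N le_rfl v
  have h2 := hN N le_rfl (v.map U)
  rw [hF U hU] at h2
  simp only [Assignment.map, hv0, hv1, Ball.mapEquiv, Equiv.coe_fn_mk, dist_eq_norm, sub_self,
    norm_zero] at h1 h2
  have h1' := abs_le.1 h1
  have h2' := abs_le.1 h2
  linarith [h1'.2, h2'.1]

/-! ### Operators that almost commute with reflections -/

theorem exists_norm_one_mem_orthogonal (hH : ¬ FiniteDimensional ℝ H) (W : Submodule ℝ H)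
    [FiniteDimensional ℝ W] : ∃ z ∈ Wᗮ, ‖z‖ = 1 := by
  have hW : Wᗮ ≠ ⊥ := fun h => hH <| by
    rw [Submodule.orthogonal_eq_bot_iff] at h
    subst h
    exact Module.Finite.equiv (Submodule.topEquiv (R := ℝ) (M := H))
  obtain ⟨z, hz, hz0⟩ := Submodule.exists_mem_ne_zero_of_ne_bot hW
  refine ⟨‖z‖⁻¹ • z, Submodule.smul_mem _ _ hz, ?_⟩
  rw [norm_smul, norm_inv, norm_norm, inv_mul_cancel₀ (norm_ne_zero_iff.2 hz0)]

theorem IsDefinable.exists_submodule_norm_sub_le {T : H →L[ℝ] H}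
    (hT : IsDefinable (T : H → H)) {ε : ℝ} (hε : 0 < ε) :
    ∃ W : Submodule ℝ H, FiniteDimensional ℝ W ∧ ∀ x ∈ Wᗮ, ‖x‖ = 1 →
      ‖T x - inner ℝ x (T x) • x‖ ≤ ε := by
  obtain ⟨F, hF⟩ := hT.exists_finset_norm_sub_le hε
  refine ⟨Submodule.span ℝ F, FiniteDimensional.span_finset ℝ F, fun x hx hx1 => ?_⟩
  have h := hF (Submodule.reflection (Submodule.span ℝ {x})ᗮ) (fun a ha => by
    refine Submodule.reflection_mem_subspace_eq_self ?_
    rw [Submodule.mem_orthogonal_singleton_iff_inner_right, real_inner_comm]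
    exact hx a (Submodule.subset_span ha)) x hx1.le
  rw [Submodule.reflection_orthogonalComplement_singleton_eq_neg,
    Submodule.reflection_orthogonal_apply, Submodule.reflection_singleton_apply] at h
  -- The commutator at `x` is `-2` times the component of `T x` orthogonal to `x`, which absorbs the
  -- factor in `2 * ε`.
  have h2 : T (-x) - -(2 • (inner ℝ x (T x) / ((‖x‖ : ℝ) ^ 2)) • x - T x) =
      (-2 : ℝ) • (T x - inner ℝ x (T x) • x) := by
    rw [hx1, map_neg]
    module
  simp only [RCLike.ofReal_real_eq_id, id_eq] at h
  rw [h2, norm_smul] at h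
  norm_num at h
  linarith

/-- The normalised `x + y` is also almost an eigenvector, with some value `r`. Comparing `T (x + y)`
with `T x + T y` costs `2ε + ε + ε`, and pairing with `x` and with `y` puts both values within `4ε`
of `r`. -/
theorem abs_inner_sub_inner_le {T : H →L[ℝ] H} {V : Submodule ℝ H} {ε : ℝ}
    (hT : ∀ x ∈ V, ‖x‖ = 1 → ‖T x - inner ℝ x (T x) • x‖ ≤ ε) {x y : H} (hx : x ∈ V) (hy : y ∈ V)
    (hx1 : ‖x‖ = 1) (hy1 : ‖y‖ = 1) (hxy : inner ℝ x y = 0) :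
    |inner ℝ x (T x) - inner ℝ y (T y)| ≤ 8 * ε := by
  have hz : ‖x + y‖ ^ 2 = 2 := by
    rw [norm_add_sq_real, hx1, hy1, hxy]; norm_num
  have hz0 : 0 < ‖x + y‖ := by
    rcases (norm_nonneg (x + y)).eq_or_lt with h | h
    · rw [← h] at hz; norm_num at hz
    · exact h
  have hz2 : ‖x + y‖ ≤ 2 := by nlinarith
  have hε : 0 ≤ ε := (norm_nonneg _).trans (hT x hx hx1)
  obtain ⟨r, hr⟩ : ∃ r : ℝ, ‖T (x + y) - r • (x + y)‖ ≤ 2 * ε := by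
    set u := ‖x + y‖⁻¹ • (x + y) with hu
    have hu1 : ‖u‖ = 1 := by
      rw [hu, norm_smul, norm_inv, norm_norm, inv_mul_cancel₀ hz0.ne']
    have hxu : x + y = ‖x + y‖ • u := by rw [hu, smul_inv_smul₀ hz0.ne']
    have h := hT u (V.smul_mem _ (V.add_mem hx hy)) hu1
    refine ⟨inner ℝ u (T u), ?_⟩
    rw [hxu, map_smul, smul_comm, ← smul_sub, norm_smul, norm_norm]
    gcongr
  have h4 : ‖(inner ℝ x (T x) - r) • x + (inner ℝ y (T y) - r) • y‖ ≤ 4 * ε := by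
    have he : (inner ℝ x (T x) - r) • x + (inner ℝ y (T y) - r) • y =
        (T (x + y) - r • (x + y)) - (T x - inner ℝ x (T x) • x)
          - (T y - inner ℝ y (T y) • y) := by
      rw [map_add]; module
    rw [he]
    refine (norm_sub_le _ _).trans ?_
    have := norm_sub_le (T (x + y) - r • (x + y)) (T x - inner ℝ x (T x) • x)
    linarith [hT x hx hx1, hT y hy hy1]
  have hyx : inner ℝ y x = 0 := by rw [real_inner_comm, hxy]
  have h5 := (abs_real_inner_le_norm x _).trans
    (mul_le_mul hx1.le h4 (norm_nonneg _) zero_le_one)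
  have h6 := (abs_real_inner_le_norm y _).trans
    (mul_le_mul hy1.le h4 (norm_nonneg _) zero_le_one)
  rw [inner_add_right, inner_smul_right, inner_smul_right, real_inner_self_eq_norm_sq, hx1, hxy]
    at h5
  rw [inner_add_right, inner_smul_right, inner_smul_right, real_inner_self_eq_norm_sq, hy1, hyx]
    at h6
  norm_num at h5 h6
  rw [abs_le] at h5 h6 ⊢
  constructor <;> linarith [h5.1, h5.2, h6.1, h6.2]

theorem exists_norm_sub_smul_le (hH : ¬ FiniteDimensional ℝ H) {T : H →L[ℝ] H}
    {W : Submodule ℝ H} [FiniteDimensional ℝ W] {ε : ℝ}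
    (hT : ∀ x ∈ Wᗮ, ‖x‖ = 1 → ‖T x - inner ℝ x (T x) • x‖ ≤ ε) :
    ∃ r : ℝ, ∀ x ∈ Wᗮ, ‖T x - r • x‖ ≤ 17 * ε * ‖x‖ := by
  obtain ⟨e, he, he1⟩ := exists_norm_one_mem_orthogonal hH W
  refine ⟨inner ℝ e (T e), ?_⟩
  have key : ∀ x ∈ Wᗮ, ‖x‖ = 1 → ‖T x - inner ℝ e (T e) • x‖ ≤ 17 * ε := by
    intro x hx hx1
    have := FiniteDimensional.span_of_finite ℝ (Set.toFinite {x, e})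
    -- `x` and `e` need not be orthogonal, so they are compared through a `z` orthogonal to both:
    -- `8ε + 8ε`, plus `ε` for `x` itself, gives 17.
    obtain ⟨z, hz, hz1⟩ := exists_norm_one_mem_orthogonal hH (W ⊔ Submodule.span ℝ {x, e})
    have hzW : z ∈ Wᗮ := Submodule.orthogonal_le le_sup_left hz
    have hxz : inner ℝ x z = 0 :=
      hz x (Submodule.mem_sup_right (Submodule.subset_span (by simp)))
    have hez : inner ℝ e z = 0 :=
      hz e (Submodule.mem_sup_right (Submodule.subset_span (by simp)))
    have h1 := abs_inner_sub_inner_le hT hx hzW hx1 hz1 hxz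
    have h2 := abs_inner_sub_inner_le hT he hzW he1 hz1 hez
    have h3 : |inner ℝ x (T x) - inner ℝ e (T e)| ≤ 16 * ε := by
      rw [abs_le] at h1 h2 ⊢
      constructor <;> linarith [h1.1, h1.2, h2.1, h2.2]
    have h4 : T x - inner ℝ e (T e) • x =
        (T x - inner ℝ x (T x) • x) + (inner ℝ x (T x) - inner ℝ e (T e)) • x := by module
    rw [h4]
    refine (norm_add_le _ _).trans ?_
    rw [norm_smul, hx1, mul_one, Real.norm_eq_abs]
    linarith [hT x hx hx1]
  intro x hx
  rcases eq_or_ne x 0 with rfl | hx0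
  · simp
  have hn : ‖x‖ ≠ 0 := norm_ne_zero_iff.2 hx0
  have h := key (‖x‖⁻¹ • x) (Submodule.smul_mem _ _ hx)
    (by rw [norm_smul, norm_inv, norm_norm, inv_mul_cancel₀ hn])
  rw [map_smul, smul_comm, ← smul_sub, norm_smul, norm_inv, norm_norm,
    inv_mul_le_iff₀ (norm_pos_iff.2 hx0)] at h
  linarith

theorem IsDefinable.exists_smul_id_add_compact [CompleteSpace H] (hH : ¬ FiniteDimensional ℝ H)
    {T : H →L[ℝ] H} (hT : IsDefinable (T : H → H)) :
    ∃ (r : ℝ) (K : H →L[ℝ] H), IsCompactOperator K ∧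
      T = r • ContinuousLinearMap.id ℝ H + K := by
  let L := compactOperator (RingHom.id ℝ) H H ⊔
    Submodule.span ℝ {ContinuousLinearMap.id ℝ H}
  have hL : IsClosed (L : Set (H →L[ℝ] H)) :=
    Submodule.isClosed_sup_finiteDimensional _ _ isClosed_setOfPred_isCompactOperator
  have hTL : T ∈ closure (L : Set (H →L[ℝ] H)) := by
    rw [Metric.mem_closure_iff]
    intro ε hε
    obtain ⟨W, hW, hTW⟩ := hT.exists_submodule_norm_sub_le (show 0 < ε / 18 by positivity)
    obtain ⟨r, hr⟩ := exists_norm_sub_smul_le hH hTW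
    let R := T - r • ContinuousLinearMap.id ℝ H
    have hWc : IsCompactOperator (R ∘L W.starProjection) :=
      have := FiniteDimensional.proper ℝ W
      (isCompactOperator_of_locallyCompactSpace_rng (R ∘L W.subtypeL)).comp_clm
        W.orthogonalProjectionOnto
    -- This approximant equals `T` on `W` and the scalar `r` on `Wᗮ`.
    refine ⟨R ∘L W.starProjection + r • ContinuousLinearMap.id ℝ H,
      Submodule.add_mem_sup hWc (Submodule.smul_mem _ _ (Submodule.mem_span_singleton_self _)), ?_⟩
    have he : T - (R ∘L W.starProjection + r • ContinuousLinearMap.id ℝ H) =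
        R ∘L Wᗮ.starProjection := by
      ext x
      simp [R]
      module
    rw [dist_eq_norm, he]
    refine lt_of_le_of_lt (b := 17 * (ε / 18))
      (ContinuousLinearMap.opNorm_le_bound _ (by positivity) fun x => ?_) (by linarith)
    refine (hr _ (Wᗮ.starProjection_apply_mem x)).trans ?_
    gcongr
    exact Wᗮ.norm_starProjection_apply_le x
  rw [hL.closure_eq] at hTL
  obtain ⟨K, hK, S, hS, rfl⟩ := Submodule.mem_sup.1 hTL
  obtain ⟨r, rfl⟩ := Submodule.mem_span_singleton.1 hS
  exact ⟨r, K, hK, add_comm _ _⟩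

/-! ### Functions that are given by formulas -/

/-- A function of the assignment that is the interpretation of a formula with parameters from `A`
and free variables in `S`. -/
def IsExpressible (A : Set H) (S : Set (ℕ+ × ℕ)) (g : Assignment H → ℝ) : Prop :=
  ∃ φ : Formula A, φ.freeVars ⊆ S ∧ ∀ v, φ.realize v = g v

namespace IsExpressible

variable {A : Set H} {S : Set (ℕ+ × ℕ)}

theorem conn {k : ℕ} {c : (Fin k → ℝ) → ℝ} (hc : Continuous c)
    {g : Fin k → Assignment H → ℝ} (hg : ∀ j, IsExpressible A S (g j)) :
    IsExpressible A S fun v => c fun j => g j v := by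
  choose φ hφ hφg using hg
  exact ⟨.conn ⟨c, hc⟩ φ, Set.iUnion_subset hφ, fun v => by simp [Formula.realize, hφg]⟩

theorem const (r : ℝ) : IsExpressible A S fun _ => r :=
  conn (c := fun _ : Fin 0 → ℝ => r) continuous_const (g := fun j _ => j.elim0)
    fun j => j.elim0

theorem comp {c : ℝ → ℝ} (hc : Continuous c) {g : Assignment H → ℝ} (hg : IsExpressible A S g) :
    IsExpressible A S fun v => c (g v) :=
  conn (c := fun t : Fin 1 → ℝ => c (t 0)) (by fun_prop) (g := fun _ => g) fun _ => hg

theorem comp₂ {c : ℝ → ℝ → ℝ} (hc : Continuous fun p : ℝ × ℝ => c p.1 p.2)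
    {g h : Assignment H → ℝ} (hg : IsExpressible A S g) (hh : IsExpressible A S h) :
    IsExpressible A S fun v => c (g v) (h v) :=
  conn (c := fun t : Fin 2 → ℝ => c (t 0) (t 1))
    (hc.comp (f := fun t : Fin 2 → ℝ => (t 0, t 1)) (by fun_prop))
    (g := ![g, h]) (by simpa [Fin.forall_fin_two] using ⟨hg, hh⟩)

theorem mul {g h : Assignment H → ℝ} (hg : IsExpressible A S g) (hh : IsExpressible A S h) :
    IsExpressible A S fun v => g v * h v :=
  comp₂ (c := fun s t => s * t) (by fun_prop) hg hh

theorem sum {ι : Type*} (s : Finset ι) {g : ι → Assignment H → ℝ}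
    (hg : ∀ i, IsExpressible A S (g i)) : IsExpressible A S fun v => ∑ i ∈ s, g i v := by
  classical
  induction s using Finset.induction_on with
  | empty => simpa using const 0
  | insert i s hi ih =>
    simp only [Finset.sum_insert hi]
    exact comp₂ (c := fun s t => s + t) (by fun_prop) (hg i) ih

theorem inner {n : ℕ+} {t s : Term A n} (ht : t.vars ⊆ S) (hs : s.vars ⊆ S) :
    IsExpressible A S fun v => Inner.inner ℝ (t.realize v : H) (s.realize v : H) :=
  ⟨.inner t s, Set.union_subset ht hs, fun _ => rfl⟩

/-- The coefficients depend on the assignment, so the sum is not a term; expanding its squared norm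
leaves only inner products of terms. -/
theorem norm_sum {ι : Type*} [Fintype ι] {n : ℕ+} {c : ι → Assignment H → ℝ}
    (hc : ∀ i, IsExpressible A S (c i)) {t : ι → Term A n} (ht : ∀ i, (t i).vars ⊆ S) :
    IsExpressible A S fun v => ‖∑ i, c i v • ((t i).realize v : H)‖ := by
  have h : ∀ v : Assignment H, ‖∑ i, c i v • ((t i).realize v : H)‖ =
      √(∑ i, ∑ j, c i v * (c j v *
        Inner.inner ℝ ((t i).realize v : H) ((t j).realize v : H))) := fun v => by
    rw [norm_eq_sqrt_real_inner, sum_inner]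
    simp only [inner_sum, real_inner_smul_left, real_inner_smul_right]
    exact congrArg _ (Finset.sum_congr rfl fun i _ => Finset.sum_congr rfl fun j _ =>
      mul_left_comm _ _ _)
  simp only [h]
  exact comp Real.continuous_sqrt (sum _ fun i => sum _ fun j =>
    (hc i).mul ((hc j).mul (inner (ht i) (ht j))))

end IsExpressible

/-! ### Scalar plus compact operators are definable -/

/-- Project onto the span of a finite `ε`-net of a compact set containing the image of the ball: net
points are fixed, so the error is at most the distance to the net. -/
theorem _root_.IsCompactOperator.exists_norm_sub_sum_inner_le [CompleteSpace H] {K : H →L[ℝ] H}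
    (hK : IsCompactOperator K) (R : ℝ) {ε : ℝ} (hε : 0 < ε) :
    ∃ (k : ℕ) (a b : Fin k → H), ∀ x, ‖x‖ ≤ R → ‖K x - ∑ i, inner ℝ (a i) x • b i‖ ≤ ε := by
  obtain ⟨C, hC, hKC⟩ :=
    hK.image_closedBall_subset_compact (f := (K : H →ₗ[ℝ] H)) (r := R)
  obtain ⟨F, -, hF, hCF⟩ := hC.finite_cover_balls hε
  let W := Submodule.span ℝ F
  have : FiniteDimensional ℝ W := FiniteDimensional.span_of_finite ℝ hF
  let b := stdOrthonormalBasis ℝ W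
  refine ⟨_, fun i => ContinuousLinearMap.adjoint K (b i), fun i => b i, fun x hx => ?_⟩
  have hP : ∑ i, inner ℝ (ContinuousLinearMap.adjoint K (b i : H)) x • (b i : H) =
      W.starProjection (K x) := by
    have := congrArg (Subtype.val) (b.sum_repr' (W.orthogonalProjectionOnto (K x)))
    simp only [AddSubmonoidClass.coe_finsetSum, SetLike.val_smul] at this
    rw [W.starProjection_apply, ← this]
    refine Finset.sum_congr rfl fun i _ => ?_
    rw [ContinuousLinearMap.adjoint_inner_left]
    congr 1
    simp
  have hxC : K x ∈ C := hKC ⟨x, by simpa using hx, rfl⟩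
  obtain ⟨z, hz, hxz⟩ := Set.mem_iUnion₂.1 (hCF hxC)
  have hzW : W.starProjection z = z :=
    W.starProjection_eq_self_iff.2 (Submodule.subset_span hz)
  have he : K x - W.starProjection (K x) = Wᗮ.starProjection (K x - z) := by
    simp [hzW]
  rw [hP, he]
  refine (Wᗮ.norm_starProjection_apply_le _).trans ?_
  rw [← dist_eq_norm]
  exact (Metric.mem_ball.1 hxz).le

theorem isExpressible_norm_finiteRank (n m : ℕ+) (r : ℝ) {k : ℕ} (a b : Fin k → H) :
    IsExpressible Set.univ {(n, 0), (m, 1)} fun v : Assignment H =>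
      ‖r • (v n 0 : H) + ∑ i, inner ℝ (a i) (v n 0 : H) • b i - (v m 1 : H)‖ := by
  -- Inner products need both terms in one sort, so everything is moved to a common ball.
  obtain ⟨N, hnN, hmN, haN, hbN⟩ : ∃ N : ℕ+, n ≤ N ∧ m ≤ N ∧ (∀ i, ‖a i‖ ≤ (N : ℝ)) ∧
      ∀ i, ‖b i‖ ≤ (N : ℝ) := by
    refine ⟨n + m + Nat.succPNat ⌈∑ i, ‖a i‖ + ∑ i, ‖b i‖⌉₊, ?_, ?_, fun i => ?_, fun i => ?_⟩
    · rw [add_assoc]; exact (PNat.lt_add_right _ _).le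
    · rw [add_comm n m, add_assoc]; exact (PNat.lt_add_right _ _).le
    all_goals
      have h1 := Nat.le_ceil (∑ i, ‖a i‖ + ∑ i, ‖b i‖)
      have h2 := Finset.single_le_sum (f := fun i => ‖a i‖) (fun _ _ => norm_nonneg _)
        (Finset.mem_univ i)
      have h3 := Finset.single_le_sum (f := fun i => ‖b i‖) (fun _ _ => norm_nonneg _)
        (Finset.mem_univ i)
      have h4 : (0 : ℝ) ≤ n := by positivity
      have h5 : (0 : ℝ) ≤ m := by positivity
      have h6 := norm_nonneg (a i)
      have h7 := norm_nonneg (b i)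
      rw [PNat.add_coe, PNat.add_coe, Nat.succPNat_coe]
      push_cast
      linarith
  let S : Set (ℕ+ × ℕ) := {(n, 0), (m, 1)}
  let x : Term (Set.univ : Set H) N := .incl hnN (.var n 0)
  let y : Term (Set.univ : Set H) N := .incl hmN (.var m 1)
  have hx : x.vars ⊆ S := by simp [x, Term.vars, S]
  have hy : y.vars ⊆ S := by simp [y, Term.vars, S]
  let t : Option (Option (Fin k)) → Term (Set.univ : Set H) N
    | none => x
    | some none => y
    | some (some i) => .param (b i) (Set.mem_univ _) N (hbN i)
  let c : Option (Option (Fin k)) → Assignment H → ℝ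
    | none => fun _ => r
    | some none => fun _ => -1
    | some (some i) => fun v => inner ℝ (a i) (v n 0 : H)
  have hc : ∀ i, IsExpressible (Set.univ : Set H) S (c i)
    | none => .const r
    | some none => .const (-1)
    | some (some i) =>
      .inner (t := .param (a i) (Set.mem_univ _) N (haN i)) (s := x) (Set.empty_subset _) hx
  have ht : ∀ i, (t i).vars ⊆ S
    | none => hx
    | some none => hy
    | some (some i) => Set.empty_subset _
  have h := IsExpressible.norm_sum hc ht
  convert! h using 3 with v
  rw [Fintype.sum_option, Fintype.sum_option]
  simp only [c, t, x, y, Term.realize, Ball.incl]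
  module

theorem isDefinable_smul_id_add [CompleteSpace H] (r : ℝ) {K : H →L[ℝ] H}
    (hK : IsCompactOperator K) :
    IsDefinable ((r • ContinuousLinearMap.id ℝ H + K : H →L[ℝ] H) : H → H) := by
  refine ⟨Set.univ, fun n => ?_, fun n m _ => ?_⟩
  · refine (ContinuousLinearMap.lipschitz _).isBounded_image ?_
    exact (Metric.isBounded_closedBall (x := (0 : H)) (r := n)).subset fun x hx => by simpa using hx
  · choose k a b hab using fun j : ℕ =>
      hK.exists_norm_sub_sum_inner_le (n : ℝ) (Nat.one_div_pos_of_nat (α := ℝ) (n := j))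
    choose φ hφ hφr using fun j => isExpressible_norm_finiteRank n m r (a j) (b j)
    refine ⟨φ, hφ, fun ε hε => ?_⟩
    obtain ⟨N, hN⟩ := exists_nat_one_div_lt hε
    refine ⟨N, fun j hj v => ?_⟩
    simp only [hφr, dist_eq_norm]
    -- By the reverse triangle inequality `y` cancels, so the approximation of `K` on the ball
    -- suffices.
    refine (abs_norm_sub_norm_le _ _).trans ?_
    rw [norm_sub_rev]
    have he : (r • ContinuousLinearMap.id ℝ H + K) (v n 0 : H) - (v m 1 : H) -
        (r • (v n 0 : H) + ∑ i, inner ℝ (a j i) (v n 0 : H) • b j i - (v m 1 : H)) =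
        K (v n 0 : H) - ∑ i, inner ℝ (a j i) (v n 0 : H) • b j i := by
      simp
    rw [he]
    exact (hab j _ (v n 0).2).trans ((Nat.one_div_le_one_div hj).trans hN.le)

/-! ### Automatic continuity and the Calkin algebra -/

theorem IsDefinable.exists_continuousLinearMap {S : H →ₗ[ℝ] H} (hS : IsDefinable (S : H → H)) :
    ∃ T : H →L[ℝ] H, (T : H →ₗ[ℝ] H) = S := by
  obtain ⟨A, hA, -⟩ := hS
  obtain ⟨C, hC⟩ := isBounded_iff_forall_norm_le.1 (hA 1)
  refine ⟨S.mkContinuousOfExistsBound ⟨C, fun x => ?_⟩, rfl⟩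
  rcases eq_or_ne x 0 with rfl | hx
  · simp
  have hn : ‖x‖ ≠ 0 := norm_ne_zero_iff.2 hx
  have h := hC (S (‖x‖⁻¹ • x)) ⟨_, by simp [norm_smul, hn], rfl⟩
  rw [map_smul, norm_smul, norm_inv, norm_norm, inv_mul_le_iff₀ (norm_pos_iff.2 hx)] at h
  linarith

theorem mem_comap_calkinMap_iff {T : H →L[ℝ] H} :
    T ∈ (⊥ : Subalgebra ℝ (Calkin H)).comap (calkinMap H) ↔
      ∃ (r : ℝ) (K : H →L[ℝ] H), IsCompactOperator K ∧
        T = r • ContinuousLinearMap.id ℝ H + K := by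
  have h : ∀ r : ℝ, algebraMap ℝ (Calkin H) r = calkinMap H T ↔
      IsCompactOperator (T - r • ContinuousLinearMap.id ℝ H) := fun r => by
    rw [← (calkinMap H).commutes, eq_comm]
    exact Ideal.Quotient.eq
  rw [Subalgebra.mem_comap, Algebra.mem_bot]
  constructor
  · rintro ⟨r, hr⟩
    exact ⟨r, _, (h r).1 hr, by abel⟩
  · rintro ⟨r, K, hK, rfl⟩
    exact ⟨r, (h r).2 (by simpa using hK)⟩

end HilbertLogic

theorem theorem3p1 {H : Type*} [NormedAddCommGroup H] [InnerProductSpace ℝ H] [CompleteSpace H]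
    (hH : ¬ FiniteDimensional ℝ H) :
    (∀ T : H →L[ℝ] H, HilbertLogic.IsDefinable (T : H → H) ↔
      ∃ (r : ℝ) (K : H →L[ℝ] H), IsCompactOperator K ∧
        T = r • ContinuousLinearMap.id ℝ H + K) ∧
    ∃ D : Subalgebra ℝ (H →L[ℝ] H),
      (∀ S : H →ₗ[ℝ] H, HilbertLogic.IsDefinable (S : H → H) ↔
        ∃ T ∈ D, (T : H →ₗ[ℝ] H) = S) ∧
      D = (⊥ : Subalgebra ℝ (HilbertLogic.Calkin H)).comap (HilbertLogic.calkinMap H) := by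
  have main : ∀ T : H →L[ℝ] H, HilbertLogic.IsDefinable (T : H → H) ↔
      ∃ (r : ℝ) (K : H →L[ℝ] H), IsCompactOperator K ∧
        T = r • ContinuousLinearMap.id ℝ H + K := fun T => by
    refine ⟨fun hT => hT.exists_smul_id_add_compact hH, ?_⟩
    rintro ⟨r, K, hK, rfl⟩
    exact HilbertLogic.isDefinable_smul_id_add r hK
  -- The final `rfl` determines `D` as the preimage of the scalars.
  refine ⟨main, _, fun S => ⟨fun hS => ?_, ?_⟩, rfl⟩
  · obtain ⟨T, rfl⟩ := hS.exists_continuousLinearMap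
    exact ⟨T, HilbertLogic.mem_comap_calkinMap_iff.2 ((main T).1 hS), rfl⟩
  · rintro ⟨T, hT, rfl⟩
    exact (main T).2 (HilbertLogic.mem_comap_calkinMap_iff.1 hT)
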